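/- Let $G\rightrightarrows M$ be a proper étale Lie groupoid with source and target maps $s,t:G\to M$, whose orbit space $X=M/G$ (an orbifold) is compact, and let $\pi:M\to X$ be the projection. Functions and 1-forms on $X$ are basic functions and basic 1-forms on $M$ (those with $s^*=t^*$), and $H^1(X)$ denotes the space of closed basic 1-forms on $M$ modulo differentials of smooth basic functions. Let $\bar v$ be a vector field on $X$, presented by vector fields $(v_1,v_0)$ on $(G,M)$ related by $s$ and by $t$, and let $\bar\Phi:\mathbb R\times X\to X$ be the continuous flow generated by $\bar v$ (it is covered by the flow of $v_0$). Let $Y\subset X$ be a closed $\bar\Phi$-invariant subset. A Lyapunov 1-form for $(\bar v,Y)$ is a closed 1-form $\bar\omega$ on $X$ such that (1) the function $\iota_{\bar v}\bar\omega$ is negative on $X-Y$, and (2) there are an open neighbourhood $\tilde U$ of $Y$ in $X$ and a smooth function $\bar f:\tilde U\to\mathbb R$ with $\bar\omega|_{\tilde U}=d\bar f$ and $d\bar f|_Y=0$. For a $\bar\Phi$-invariant positive (finite Borel) measure $\bar\mu$ on $X$, the asymptotic cycle $\mathcal A_\mu\in H_1(X,\mathbb R)\cong H^1(X)^*$ is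 the class with $\langle[\bar\omega],\mathcal A_\mu\rangle=\int_X\iota_{\bar v}\bar\omega\,d\bar\mu$ for all closed 1-forms $\bar\omega$ on $X$ (the integral depends only on the class $[\bar\omega]$). Assume that there exists a Lyapunov 1-form for $(\bar v,Y)$ in the cohomology class $\xi\in H^1(X)$. Then $\langle\xi,\mathcal A_\mu\rangle\le 0$ for every $\bar\Phi$-invariant positive measure $\bar\mu$ on $X$, and equality holds if and only if $\bar\mu(X-Y)=0$. Moreover, the restriction $\xi|_Y\in\check H^1(Y,\mathbb R)$ of $\xi$ to $Y$ in Čech cohomology vanishes; here $H^1(X)\to\check H^1(X,\mathbb R)$ sends the class of a closed 1-form with local primitives $f_a$ on the members of an open cover to the class of the cocycle $(f_b-f_a)$. -/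

import Mathlib

open Set Filter Topology MeasureTheory
open scoped Manifold ContDiff

noncomputable section

/-! ### Čech cohomology in degree one -/

namespace Cech

/-- `f` is locally constant at every point of `s` (used for open sets `s`). -/
def LocConstOn {Y : Type*} [TopologicalSpace Y] (f : Y → ℝ) (s : Set Y) : Prop :=
  ∀ x ∈ s, ∀ᶠ y in 𝓝 x, f y = f x

/-- An open cover of `Y` indexed by the points of `Y`, the set with index `y` containing `y`.
Every open cover is refined by one of this form. -/
structure PointedCover (Y : Type*) [TopologicalSpace Y] where
  set : Y → Set Y
  isOpen : ∀ y, IsOpen (set y)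
  mem : ∀ y, y ∈ set y

variable {Y Z : Type*} [TopologicalSpace Y] [TopologicalSpace Z]

/-- `c` is a Čech 1-cocycle of the cover `U` with values in the constant sheaf `ℝ`. The value
`c a b z` is relevant only for `z ∈ U a ∩ U b`. -/
def IsCocycle (U : PointedCover Y) (c : Y → Y → Y → ℝ) : Prop :=
  (∀ a b, LocConstOn (c a b) (U.set a ∩ U.set b)) ∧
    ∀ a b d, ∀ z ∈ U.set a ∩ U.set b ∩ U.set d, c a b z + c b d z = c a d z

/-- On the cover `U`, `c` is the Čech coboundary of a 0-cochain with values in the constant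
sheaf `ℝ`. -/
def IsCoboundary (U : PointedCover Y) (c : Y → Y → Y → ℝ) : Prop :=
  ∃ b : Y → Y → ℝ, (∀ a, LocConstOn (b a) (U.set a)) ∧
    ∀ a a', ∀ z ∈ U.set a ∩ U.set a', c a a' z = b a' z - b a z

theorem LocConstOn.mono {f : Y → ℝ} {s t : Set Y} (h : LocConstOn f t) (hst : s ⊆ t) :
    LocConstOn f s := fun x hx => h x (hst hx)

theorem LocConstOn.add {f g : Y → ℝ} {s : Set Y} (hf : LocConstOn f s) (hg : LocConstOn g s) :
    LocConstOn (f + g) s := fun x hx => by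
  filter_upwards [hf x hx, hg x hx] with y h1 h2
  simp [h1, h2]

theorem LocConstOn.smul {f : Y → ℝ} {s : Set Y} (r : ℝ) (hf : LocConstOn f s) :
    LocConstOn (r • f) s := fun x hx => by
  filter_upwards [hf x hx] with y h1
  simp [h1]

theorem LocConstOn.comp {f : Z → ℝ} {s : Set Z} (hf : LocConstOn f s) {φ : Y → Z}
    (hφ : Continuous φ) : LocConstOn (fun y => f (φ y)) (φ ⁻¹' s) := fun x hx =>
  hφ.continuousAt.eventually (hf (φ x) hx)

/-- The common refinement of two pointed covers. -/
def PointedCover.inf (U V : PointedCover Y) : PointedCover Y where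
  set y := U.set y ∩ V.set y
  isOpen y := (U.isOpen y).inter (V.isOpen y)
  mem y := ⟨U.mem y, V.mem y⟩

/-- The pullback of a pointed cover. -/
def PointedCover.pullback (U : PointedCover Z) (φ : C(Y, Z)) : PointedCover Y where
  set y := φ ⁻¹' U.set (φ y)
  isOpen y := (U.isOpen (φ y)).preimage φ.continuous
  mem y := U.mem (φ y)

theorem IsCocycle.mono {U V : PointedCover Y} {c : Y → Y → Y → ℝ} (h : IsCocycle V c)
    (hUV : ∀ y, U.set y ⊆ V.set y) : IsCocycle U c :=
  ⟨fun a b => (h.1 a b).mono (inter_subset_inter (hUV a) (hUV b)),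
    fun a b d z hz => h.2 a b d z ⟨⟨hUV a hz.1.1, hUV b hz.1.2⟩, hUV d hz.2⟩⟩

theorem IsCoboundary.mono {U V : PointedCover Y} {c : Y → Y → Y → ℝ} (h : IsCoboundary V c)
    (hUV : ∀ y, U.set y ⊆ V.set y) : IsCoboundary U c := by
  obtain ⟨b, hb, hc⟩ := h
  exact ⟨b, fun a => (hb a).mono (hUV a), fun a a' z hz => hc a a' z ⟨hUV a hz.1, hUV a' hz.2⟩⟩

variable (Y)

/-- The trivial pointed cover. -/
def PointedCover.top : PointedCover Y where
  set _ := univ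
  isOpen _ := isOpen_univ
  mem _ := mem_univ _

/-- The union of the spaces of real Čech 1-cocycles of all pointed covers of `Y`. -/
def cocycles : Submodule ℝ (Y → Y → Y → ℝ) where
  carrier := {c | ∃ U, IsCocycle U c}
  zero_mem' := ⟨PointedCover.top Y, fun _ _ _ _ => Eventually.of_forall fun _ => rfl,
    fun _ _ _ _ _ => by simp⟩
  add_mem' := by
    rintro c c' ⟨U, h⟩ ⟨V, h'⟩
    have h := h.mono (U := U.inf V) fun y => inter_subset_left
    have h' := h'.mono (U := U.inf V) fun y => inter_subset_right
    refine ⟨U.inf V, fun a b => (h.1 a b).add (h'.1 a b), fun a b d z hz => ?_⟩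
    have e := h.2 a b d z hz
    have e' := h'.2 a b d z hz
    simp only [Pi.add_apply]
    linarith
  smul_mem' := by
    rintro r c ⟨U, h⟩
    refine ⟨U, fun a b => (h.1 a b).smul r, fun a b d z hz => ?_⟩
    simp only [Pi.smul_apply, smul_eq_mul, ← h.2 a b d z hz]
    ring

/-- The union of the spaces of real Čech 1-coboundaries of all pointed covers of `Y`. -/
def coboundaries : Submodule ℝ (Y → Y → Y → ℝ) where
  carrier := {c | ∃ U, IsCoboundary U c}
  zero_mem' := ⟨PointedCover.top Y, 0, fun _ _ _ => Eventually.of_forall fun _ => rfl,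
    fun _ _ _ _ => by simp⟩
  add_mem' := by
    rintro c c' ⟨U, h⟩ ⟨V, h'⟩
    obtain ⟨b, hb, hc⟩ := h.mono (U := U.inf V) fun y => inter_subset_left
    obtain ⟨b', hb', hc'⟩ := h'.mono (U := U.inf V) fun y => inter_subset_right
    refine ⟨U.inf V, b + b', fun a => (hb a).add (hb' a), fun a a' z hz => ?_⟩
    simp only [Pi.add_apply, hc a a' z hz, hc' a a' z hz]
    ring
  smul_mem' := by
    rintro r c ⟨U, b, hb, hc⟩
    refine ⟨U, r • b, fun a => (hb a).smul r, fun a a' z hz => ?_⟩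
    simp only [Pi.smul_apply, smul_eq_mul, hc a a' z hz]
    ring

/-- The first Čech cohomology `Ȟ¹(Y, ℝ)` of a topological space `Y` with coefficients in the
constant sheaf `ℝ`: the direct limit, over the open covers `U` of `Y` under refinement, of the
spaces (cocycles of `U`) / (coboundaries of `U`). The pointed covers are cofinal among all open
covers, and for a refinement of pointed covers (`U' y ⊆ U y` for all `y`) the transition map is
induced by the restriction of functions. As a cochain is represented by functions that are defined
everywhere but matter on the overlaps only (a change off the overlaps of `U` is the coboundary of
`0`), the transition maps come from the inclusions of the spaces of cocycles and of coboundaries,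
so that the limit is the quotient of the union of the former by the union of the latter. -/
abbrev H1 : Type _ := cocycles Y ⧸ (coboundaries Y).submoduleOf (cocycles Y)

variable {Y}

/-- The pullback of Čech cocycles along a continuous map. -/
def pullbackCocycle (φ : C(Y, Z)) : cocycles Z →ₗ[ℝ] cocycles Y where
  toFun c := ⟨fun a b z => c.1 (φ a) (φ b) (φ z), by
    obtain ⟨c, U, h⟩ := c
    exact ⟨U.pullback φ, fun a b => (h.1 (φ a) (φ b)).comp φ.continuous,
      fun a b d z hz => h.2 (φ a) (φ b) (φ d) (φ z) hz⟩⟩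
  map_add' _ _ := rfl
  map_smul' _ _ := rfl

/-- The map `Ȟ¹(Z, ℝ) → Ȟ¹(Y, ℝ)` induced by a continuous map `Y → Z`. -/
def H1.map (φ : C(Y, Z)) : H1 Z →ₗ[ℝ] H1 Y :=
  Submodule.mapQ _ _ (pullbackCocycle φ) (by
    rintro ⟨c, hc⟩ ⟨U, b, hb, h⟩
    exact ⟨U.pullback φ, fun a z => b (φ a) (φ z), fun a => (hb (φ a)).comp φ.continuous,
      fun a a' z hz => h (φ a) (φ a') (φ z) hz⟩)

end Cech

/-- A proper étale Lie groupoid `G ⇉ M`, all of whose data are smooth. The manifolds `M` and `G` are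
modelled on the same space `E` (`src` being a local diffeomorphism, their dimensions agree). The
product `mul g h` (first `h`, then `g`) is meaningful only if `src g = tgt h`. -/
structure ProperEtaleGroupoid (E : Type*) [NormedAddCommGroup E] [NormedSpace ℝ E]
    (M : Type*) [TopologicalSpace M] [ChartedSpace E M]
    (G : Type*) [TopologicalSpace G] [ChartedSpace E G] where
  /-- the source of an arrow -/
  src : G → M
  /-- the target of an arrow -/
  tgt : G → M
  /-- the unit arrow at a point -/
  unit : M → G
  /-- the inverse of an arrow -/
  inv : G → G
  /-- the composition of arrows -/
  mul : G → G → G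
  src_unit : ∀ x, src (unit x) = x
  tgt_unit : ∀ x, tgt (unit x) = x
  src_inv : ∀ g, src (inv g) = tgt g
  tgt_inv : ∀ g, tgt (inv g) = src g
  src_mul : ∀ g h, src g = tgt h → src (mul g h) = src h
  tgt_mul : ∀ g h, src g = tgt h → tgt (mul g h) = tgt g
  mul_assoc : ∀ g h k, src g = tgt h → src h = tgt k → mul (mul g h) k = mul g (mul h k)
  unit_mul : ∀ g, mul (unit (tgt g)) g = g
  mul_unit : ∀ g, mul g (unit (src g)) = g
  inv_mul : ∀ g, mul (inv g) g = unit (src g)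
  mul_inv : ∀ g, mul g (inv g) = unit (tgt g)
  contMDiff_src : ContMDiff 𝓘(ℝ, E) 𝓘(ℝ, E) ∞ src
  contMDiff_tgt : ContMDiff 𝓘(ℝ, E) 𝓘(ℝ, E) ∞ tgt
  contMDiff_unit : ContMDiff 𝓘(ℝ, E) 𝓘(ℝ, E) ∞ unit
  contMDiff_inv : ContMDiff 𝓘(ℝ, E) 𝓘(ℝ, E) ∞ inv
  contMDiffOn_mul : ContMDiffOn (𝓘(ℝ, E).prod 𝓘(ℝ, E)) 𝓘(ℝ, E) ∞
    (fun p : G × G => mul p.1 p.2) {p | src p.1 = tgt p.2}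
  etale : IsLocalDiffeomorph 𝓘(ℝ, E) 𝓘(ℝ, E) ∞ src
  proper : IsProperMap fun g => (src g, tgt g)

namespace ProperEtaleGroupoid

variable {E : Type*} [NormedAddCommGroup E] [NormedSpace ℝ E]
  {M : Type*} [TopologicalSpace M] [ChartedSpace E M]
  {G : Type*} [TopologicalSpace G] [ChartedSpace E G]

/-! ### The orbit space -/

variable {𝒢 : ProperEtaleGroupoid E M G}

/-- Two points are equivalent if there is an arrow from the first to the second. -/
def orbitRel (𝒢 : ProperEtaleGroupoid E M G) : Setoid M where
  r x y := ∃ g, 𝒢.src g = x ∧ 𝒢.tgt g = y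
  iseqv :=
    { refl := fun x => ⟨𝒢.unit x, 𝒢.src_unit x, 𝒢.tgt_unit x⟩
      symm := by
        rintro x y ⟨g, rfl, rfl⟩
        exact ⟨𝒢.inv g, 𝒢.src_inv g, 𝒢.tgt_inv g⟩
      trans := by
        rintro x y z ⟨g, rfl, rfl⟩ ⟨h, hx, rfl⟩
        exact ⟨𝒢.mul h g, 𝒢.src_mul h g hx, 𝒢.tgt_mul h g hx⟩ }

/-- The orbit space `X = M / G`, with the quotient topology and its Borel σ-algebra. -/
def OrbitSpace (𝒢 : ProperEtaleGroupoid E M G) : Type _ := Quotient 𝒢.orbitRel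

instance : TopologicalSpace 𝒢.OrbitSpace := inferInstanceAs (TopologicalSpace (Quotient 𝒢.orbitRel))

instance : MeasurableSpace 𝒢.OrbitSpace := borel _

instance : BorelSpace 𝒢.OrbitSpace := ⟨rfl⟩

/-- The orbit projection `π : M → X`. -/
def proj (𝒢 : ProperEtaleGroupoid E M G) (x : M) : 𝒢.OrbitSpace := Quotient.mk 𝒢.orbitRel x

theorem continuous_proj : Continuous 𝒢.proj := continuous_quotient_mk'

theorem proj_surjective : Function.Surjective 𝒢.proj := Quotient.mk_surjective

theorem proj_eq_iff {x y : M} : 𝒢.proj x = 𝒢.proj y ↔ ∃ g, 𝒢.src g = x ∧ 𝒢.tgt g = y :=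
  Quotient.eq (r := 𝒢.orbitRel)

theorem proj_src (g : G) : 𝒢.proj (𝒢.src g) = 𝒢.proj (𝒢.tgt g) := proj_eq_iff.2 ⟨g, rfl, rfl⟩

theorem inv_inv (g : G) : 𝒢.inv (𝒢.inv g) = g := by
  have h1 := 𝒢.mul_assoc (𝒢.inv (𝒢.inv g)) (𝒢.inv g) g (𝒢.src_inv _) (𝒢.src_inv _)
  rw [𝒢.inv_mul, 𝒢.inv_mul, 𝒢.src_inv, 𝒢.unit_mul] at h1
  have h2 := 𝒢.mul_unit (𝒢.inv (𝒢.inv g))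
  rw [𝒢.src_inv, 𝒢.tgt_inv] at h2
  exact (h1.trans h2).symm

theorem isLocalDiffeomorph_tgt (𝒢 : ProperEtaleGroupoid E M G) :
    IsLocalDiffeomorph 𝓘(ℝ, E) 𝓘(ℝ, E) ∞ 𝒢.tgt := by
  let φ : Diffeomorph 𝓘(ℝ, E) 𝓘(ℝ, E) G G ∞ :=
    { toFun := 𝒢.inv
      invFun := 𝒢.inv
      left_inv := inv_inv
      right_inv := inv_inv
      contMDiff_toFun := 𝒢.contMDiff_inv
      contMDiff_invFun := 𝒢.contMDiff_inv }
  intro g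
  have h : 𝒢.tgt = 𝒢.src ∘ φ := funext fun g => (𝒢.src_inv g).symm
  rw [h]
  exact (φ.isLocalDiffeomorph g).comp _ _ (𝒢.etale (φ g))

theorem isOpenMap_proj : IsOpenMap 𝒢.proj := by
  intro V hV
  have h : 𝒢.proj ⁻¹' (𝒢.proj '' V) = 𝒢.tgt '' (𝒢.src ⁻¹' V) := by
    ext y
    constructor
    · rintro ⟨x, hx, hxy⟩
      obtain ⟨g, rfl, rfl⟩ := proj_eq_iff.1 hxy
      exact ⟨g, hx, rfl⟩
    · rintro ⟨g, hg, rfl⟩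
      exact ⟨𝒢.src g, hg, proj_src g⟩
  have : IsOpen (𝒢.proj ⁻¹' (𝒢.proj '' V)) := by
    rw [h]
    exact 𝒢.isLocalDiffeomorph_tgt.isLocalHomeomorph.isOpenMap _
      (hV.preimage 𝒢.contMDiff_src.continuous)
  exact (isQuotientMap_quotient_mk' (s := 𝒢.orbitRel)).isOpen_preimage.1 this

/-! ### Vector fields and 1-forms on a manifold -/

variable (E M) in
/-- Smooth 1-forms on `M`, i.e. smooth sections of the cotangent bundle. -/
abbrev OneForm [IsManifold 𝓘(ℝ, E) ∞ M] : Type _ :=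
  Cₛ^∞⟮𝓘(ℝ, E); E →L[ℝ] ℝ,
    fun x : M => TangentSpace 𝓘(ℝ, E) x →L[ℝ] Bundle.Trivial M ℝ x⟯

variable (E M) in
/-- Smooth vector fields on `M`, i.e. smooth sections of the tangent bundle. -/
abbrev VectorField [IsManifold 𝓘(ℝ, E) ∞ M] : Type _ :=
  Cₛ^∞⟮𝓘(ℝ, E); E, (TangentSpace 𝓘(ℝ, E) : M → Type _)⟯

variable [IsManifold 𝓘(ℝ, E) ∞ M]

/-- The value `η_x(w)` of a 1-form on a tangent vector `w` at `x`. -/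
def OneForm.eval (η : OneForm E M) (x : M) (w : TangentSpace 𝓘(ℝ, E) x) : ℝ := η x w

/-- The expression of the 1-form `η` in the preferred chart at `x`, i.e. the pullback of `η` to `E`
along the inverse of the chart. It is relevant on the target of the chart. -/
def OneForm.chartRep (η : OneForm E M) (x : M) (u : E) : E →L[ℝ] ℝ :=
  (η ((chartAt E x).symm u)).comp (mfderiv 𝓘(ℝ, E) 𝓘(ℝ, E) (chartAt E x).symm u)

theorem OneForm.chartRep_contDiffOn (η : OneForm E M) (x : M) :
    ContDiffOn ℝ ∞ (η.chartRep x) (chartAt E x).target := by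
  have h0 : ContMDiffOn 𝓘(ℝ, E) (𝓘(ℝ, E).prod 𝓘(ℝ, E →L[ℝ] ℝ)) ∞
      (fun y => (⟨y, η y⟩ : Bundle.TotalSpace (E →L[ℝ] ℝ)
        fun x : M => TangentSpace 𝓘(ℝ, E) x →L[ℝ] Bundle.Trivial M ℝ x))
      (trivializationAt (E →L[ℝ] ℝ)
        (fun x : M => TangentSpace 𝓘(ℝ, E) x →L[ℝ] Bundle.Trivial M ℝ x) x).baseSet :=
    η.contMDiff.contMDiffOn
  rw [Bundle.Trivialization.contMDiffOn_section_baseSet_iff] at h0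
  have h1 : ContMDiffOn 𝓘(ℝ, E) 𝓘(ℝ, E) ∞ (chartAt E x).symm (chartAt E x).target :=
    contMDiffOn_chart_symm
  have hb : (trivializationAt (E →L[ℝ] ℝ)
        (fun x : M => TangentSpace 𝓘(ℝ, E) x →L[ℝ] Bundle.Trivial M ℝ x) x).baseSet
        = (chartAt E x).source := by
    simp [hom_trivializationAt_baseSet]
  rw [hb] at h0
  have h2 := h0.comp h1 (fun u hu => (chartAt E x).map_target hu)
  rw [contMDiffOn_iff_contDiffOn] at h2
  refine h2.congr fun u hu => ?_
  have hs := (chartAt E x).map_target hu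
  simp only [Function.comp, hom_trivializationAt_apply]
  rw [ContinuousLinearMap.inCoordinates_eq]
  rotate_left
  · simpa using hs
  · simp
  ext w
  have hw := congrArg (fun A => A w) (TangentBundle.symmL_trivializationAt (I := 𝓘(ℝ, E)) hs)
  have hext : (extChartAt 𝓘(ℝ, E) x) ((chartAt E x).symm u) = u := by
    simp [extChartAt, (chartAt E x).right_inv hu]
  have hd : ∀ u' : E, u' = u →
      (mfderivWithin 𝓘(ℝ, E) 𝓘(ℝ, E) (extChartAt 𝓘(ℝ, E) x).symm (range 𝓘(ℝ, E)) u' : E →L[ℝ] E) w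
        = (mfderiv 𝓘(ℝ, E) 𝓘(ℝ, E) (chartAt E x).symm u : E →L[ℝ] E) w := by
    rintro _ rfl
    rw [modelWithCornersSelf_coe, range_id, mfderivWithin_univ]
    rfl
  refine (congrArg (η ((chartAt E x).symm u)) ((hw.trans (hd _ hext)).symm)).trans ?_
  rw [Bundle.Trivialization.symmL_apply _ (by simpa using hs)]
  simp

/-- `dη = 0`: the exterior derivative of `η` vanishes in the charts of `M`. -/
def OneForm.IsClosed (η : OneForm E M) : Prop :=
  ∀ x : M, ∀ u ∈ (chartAt E x).target,
    extDeriv (fun u => ContinuousAlternatingMap.ofSubsingleton ℝ E ℝ (0 : Fin 1)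
      (η.chartRep x u)) u = 0

theorem OneForm.isClosed_iff (η : OneForm E M) : η.IsClosed ↔
    ∀ x : M, ∀ u ∈ (chartAt E x).target, ∀ a b,
      fderiv ℝ (η.chartRep x) u a b = fderiv ℝ (η.chartRep x) u b a := by
  refine forall_congr' fun x => forall₂_congr fun u hu => ?_
  have hd : DifferentiableAt ℝ (η.chartRep x) u :=
    ((η.chartRep_contDiffOn x).contDiffAt ((chartAt E x).open_target.mem_nhds hu)).differentiableAt
      (by simp)
  have hd' : DifferentiableAt ℝ (fun u => ContinuousAlternatingMap.ofSubsingleton ℝ E ℝ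
      (0 : Fin 1) (η.chartRep x u)) u :=
    ((ContinuousAlternatingMap.ofSubsingletonLIE (𝕜 := ℝ) (E := E) (F := ℝ)
      (0 : Fin 1)).toContinuousLinearEquiv.differentiableAt).comp u hd
  have key : ∀ w : Fin 2 → E, extDeriv (fun u => ContinuousAlternatingMap.ofSubsingleton ℝ E ℝ
      (0 : Fin 1) (η.chartRep x u)) u w =
      fderiv ℝ (η.chartRep x) u (w 0) (w 1) - fderiv ℝ (η.chartRep x) u (w 1) (w 0) := by
    intro w
    have hc : ∀ e : E, fderiv ℝ (fun y => η.chartRep x y e) u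
        = (fderiv ℝ (η.chartRep x) u).flip e := by
      intro e
      rw [fderiv_clm_apply hd (differentiableAt_const e)]
      simp
    rw [extDeriv_apply hd']
    simp [Fin.sum_univ_two, hc, Fin.removeNth, sub_eq_add_neg]
  constructor
  · intro h a b
    have := key ![a, b]
    rw [h] at this
    simp at this
    linarith
  · intro h
    ext w
    rw [key, h (w 0) (w 1)]
    simp

theorem OneForm.chartRep_add (η θ : OneForm E M) (x : M) :
    (η + θ).chartRep x = η.chartRep x + θ.chartRep x := rfl

theorem OneForm.chartRep_smul (r : ℝ) (η : OneForm E M) (x : M) :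
    (r • η).chartRep x = r • η.chartRep x := rfl

theorem OneForm.differentiableAt_chartRep (η : OneForm E M) {x : M} {u : E}
    (hu : u ∈ (chartAt E x).target) : DifferentiableAt ℝ (η.chartRep x) u :=
  ((η.chartRep_contDiffOn x).contDiffAt ((chartAt E x).open_target.mem_nhds hu)).differentiableAt
      (by simp)

theorem OneForm.IsClosed.add {η θ : OneForm E M} (hη : η.IsClosed) (hθ : θ.IsClosed) :
    (η + θ).IsClosed := by
  rw [OneForm.isClosed_iff] at *
  intro x u hu a b
  rw [OneForm.chartRep_add, fderiv_add (η.differentiableAt_chartRep hu)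
    (θ.differentiableAt_chartRep hu)]
  simp [hη x u hu a b, hθ x u hu a b]

theorem OneForm.IsClosed.smul {η : OneForm E M} (r : ℝ) (hη : η.IsClosed) :
    (r • η).IsClosed := by
  rw [OneForm.isClosed_iff] at *
  intro x u hu a b
  rw [OneForm.chartRep_smul, fderiv_const_smul (η.differentiableAt_chartRep hu)]
  simp [hη x u hu a b]

theorem OneForm.isClosed_zero : (0 : OneForm E M).IsClosed := by
  rw [OneForm.isClosed_iff]
  intro x u hu a b
  have : (0 : OneForm E M).chartRep x = 0 := rfl
  simp [this]

/-- The value `df_x(w)` of the differential of `f` on a tangent vector `w` at `x`. -/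
def dAt (f : M → ℝ) (x : M) (w : TangentSpace 𝓘(ℝ, E) x) : ℝ := mfderiv 𝓘(ℝ, E) 𝓘(ℝ, ℝ) f x w

theorem OneForm.IsClosed.exists_primitive {η : OneForm E M} (hη : η.IsClosed) (x : M) :
    ∃ (V : Set M) (f : M → ℝ), IsOpen V ∧ x ∈ V ∧ ContMDiffOn 𝓘(ℝ, E) 𝓘(ℝ, ℝ) ∞ f V ∧
      ∀ y ∈ V, ∀ w : TangentSpace 𝓘(ℝ, E) y, dAt f y w = η.eval y w := by
  rw [OneForm.isClosed_iff] at hη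
  set e := chartAt E x with he
  obtain ⟨r, hr, hB⟩ := Metric.isOpen_iff.1 e.open_target (e x) (mem_chart_target E x)
  obtain ⟨f, hf⟩ := (convex_ball (e x) r).exists_forall_hasFDerivAt_of_fderiv_symmetric
    Metric.isOpen_ball
    (fun u hu => (η.differentiableAt_chartRep (hB hu)).differentiableWithinAt)
    (fun u hu a b => hη x u (hB hu) a b)
  have hfs : ContDiffOn ℝ ∞ f (Metric.ball (e x) r) := by
    rw [contDiffOn_infty_iff_fderiv_of_isOpen Metric.isOpen_ball]
    refine ⟨fun u hu => (hf u hu).differentiableAt.differentiableWithinAt, ?_⟩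
    exact ((η.chartRep_contDiffOn x).mono hB).congr fun u hu => (hf u hu).fderiv
  have hes : ContMDiffOn 𝓘(ℝ, E) 𝓘(ℝ, E) ∞ e e.source := contMDiffOn_chart
  refine ⟨e.source ∩ e ⁻¹' Metric.ball (e x) r, f ∘ e,
    e.isOpen_inter_preimage Metric.isOpen_ball, ⟨mem_chart_source E x, by simpa using hr⟩, ?_, ?_⟩
  · exact hfs.contMDiffOn.comp (hes.mono inter_subset_left) fun y hy => hy.2
  · rintro y ⟨hy, hyB⟩ w
    have he' : MDifferentiableAt 𝓘(ℝ, E) 𝓘(ℝ, E) e y :=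
      (hes.contMDiffAt (e.open_source.mem_nhds hy)).mdifferentiableAt (by simp)
    have hsy : MDifferentiableAt 𝓘(ℝ, E) 𝓘(ℝ, E) e.symm (e y) :=
      (ContMDiffOn.contMDiffAt (contMDiffOn_chart_symm (n := ∞))
        (e.open_target.mem_nhds (e.map_source hy))).mdifferentiableAt (by simp)
    have hfm : HasMFDerivAt 𝓘(ℝ, E) 𝓘(ℝ, ℝ) f (e y) (η.chartRep x (e y)) :=
      (hf _ hyB).hasMFDerivAt
    have hc := hfm.comp y he'.hasMFDerivAt
    have hid : (mfderiv 𝓘(ℝ, E) 𝓘(ℝ, E) e.symm (e y)).comp (mfderiv 𝓘(ℝ, E) 𝓘(ℝ, E) e y)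
        = ContinuousLinearMap.id ℝ (TangentSpace 𝓘(ℝ, E) y) := by
      have h1 := hsy.hasMFDerivAt.comp y he'.hasMFDerivAt
      have h2 : HasMFDerivAt 𝓘(ℝ, E) 𝓘(ℝ, E) (e.symm ∘ e) y
          (ContinuousLinearMap.id ℝ (TangentSpace 𝓘(ℝ, E) y)) := by
        refine (hasMFDerivAt_id y).congr_of_eventuallyEq ?_
        filter_upwards [e.open_source.mem_nhds hy] with z hz
        exact e.left_inv hz
      exact hasMFDerivAt_unique h1 h2
    have hid' := congrArg (fun A => A w) hid
    simp only [dAt]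
    rw [hc.mfderiv]
    have hη : ∀ z, z = y → ∀ w' : E, (η z : E →L[ℝ] ℝ) w' = (η y : E →L[ℝ] ℝ) w' := by
      rintro _ rfl _
      rfl
    refine (hη _ (e.left_inv hy) _).trans ?_
    exact congrArg (η y : E →L[ℝ] ℝ) hid'

theorem locConstOn_of_dAt_eq_zero {f : M → ℝ} {V : Set M} (hV : IsOpen V)
    (hf : ContMDiffOn 𝓘(ℝ, E) 𝓘(ℝ, ℝ) ∞ f V)
    (h0 : ∀ y ∈ V, ∀ w : TangentSpace 𝓘(ℝ, E) y, dAt f y w = 0) :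
    ∀ x ∈ V, ∀ᶠ y in 𝓝 x, f y = f x := by
  intro x hx
  set e := chartAt E x with he
  have hxs := mem_chart_source E x
  have hO : IsOpen (e.target ∩ e.symm ⁻¹' V) := e.symm.isOpen_inter_preimage hV
  obtain ⟨r, hr, hB⟩ := Metric.isOpen_iff.1 hO (e x)
    ⟨mem_chart_target E x, by simpa [he] using hx⟩
  have hd : ∀ u ∈ Metric.ball (e x) r, HasFDerivAt (f ∘ e.symm) (0 : E →L[ℝ] ℝ) u := by
    intro u hu
    have hsy : MDifferentiableAt 𝓘(ℝ, E) 𝓘(ℝ, E) e.symm u :=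
      (ContMDiffOn.contMDiffAt (contMDiffOn_chart_symm (n := ∞))
        (e.open_target.mem_nhds (hB hu).1)).mdifferentiableAt (by simp)
    have hfm : MDifferentiableAt 𝓘(ℝ, E) 𝓘(ℝ, ℝ) f (e.symm u) :=
      (hf.contMDiffAt (hV.mem_nhds (hB hu).2)).mdifferentiableAt (by simp)
    have hc := hfm.hasMFDerivAt.comp u hsy.hasMFDerivAt
    rw [hasMFDerivAt_iff_hasFDerivAt] at hc
    have hz : (mfderiv 𝓘(ℝ, E) 𝓘(ℝ, ℝ) f (e.symm u)).comp (mfderiv 𝓘(ℝ, E) 𝓘(ℝ, E) e.symm u)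
        = (0 : E →L[ℝ] ℝ) := by
      ext w
      exact h0 _ (hB hu).2 _
    exact hz ▸ hc
  have hconst : ∀ u ∈ Metric.ball (e x) r, (f ∘ e.symm) u = (f ∘ e.symm) (e x) := by
    intro u hu
    exact (convex_ball (e x) r).is_const_of_fderivWithin_eq_zero (𝕜 := ℝ)
      (fun z hz => (hd z hz).differentiableAt.differentiableWithinAt)
      (fun z hz => (hd z hz).hasFDerivWithinAt.fderivWithin
        (Metric.isOpen_ball.uniqueDiffWithinAt hz)) hu (Metric.mem_ball_self hr)
  have hn : e.source ∩ e ⁻¹' Metric.ball (e x) r ∈ 𝓝 x :=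
    (e.isOpen_inter_preimage Metric.isOpen_ball).mem_nhds ⟨hxs, by simpa using hr⟩
  filter_upwards [hn] with y hy
  have := hconst _ hy.2
  simpa [e.left_inv hy.1, e.left_inv hxs] using this


/-! ### Basic forms, de Rham cohomology and homology of the orbit space -/

/-- The 1-form `η` is basic: `t^* η = s^* η`. Basic forms on `M` are the forms on `X`. -/
def IsBasic (𝒢 : ProperEtaleGroupoid E M G) (η : OneForm E M) : Prop :=
  ∀ (g : G) (w : TangentSpace 𝓘(ℝ, E) g),
    η.eval (𝒢.tgt g) (mfderiv 𝓘(ℝ, E) 𝓘(ℝ, E) 𝒢.tgt g w) =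
      η.eval (𝒢.src g) (mfderiv 𝓘(ℝ, E) 𝓘(ℝ, E) 𝒢.src g w)

/-- The closed basic 1-forms on `M`, i.e. the closed 1-forms on `X`. -/
def closedBasic (𝒢 : ProperEtaleGroupoid E M G) : Submodule ℝ (OneForm E M) where
  carrier := {η | 𝒢.IsBasic η ∧ η.IsClosed}
  zero_mem' := ⟨fun _ _ => rfl, OneForm.isClosed_zero⟩
  add_mem' := fun h h' =>
    ⟨fun g w => congrArg₂ (· + ·) (h.1 g w) (h'.1 g w), h.2.add h'.2⟩
  smul_mem' := fun r _ h => ⟨fun g w => congrArg (r * ·) (h.1 g w), h.2.smul r⟩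

/-- The function `f` is smooth on the subset `V` of `X`, and `η = df` there: `f ∘ π` is smooth on
`π⁻¹(V)`, with differential `η`. (Functions on `X` correspond to the `G`-invariant, or basic,
functions on `M`; `V` is open in all uses.) -/
def IsPrimitiveOn (𝒢 : ProperEtaleGroupoid E M G) (η : OneForm E M) (V : Set 𝒢.OrbitSpace)
    (f : 𝒢.OrbitSpace → ℝ) : Prop :=
  ContMDiffOn 𝓘(ℝ, E) 𝓘(ℝ, ℝ) ∞ (f ∘ 𝒢.proj) (𝒢.proj ⁻¹' V) ∧
    ∀ x ∈ 𝒢.proj ⁻¹' V, ∀ w : TangentSpace 𝓘(ℝ, E) x, dAt (f ∘ 𝒢.proj) x w = η.eval x w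

theorem IsPrimitiveOn.mono {η : OneForm E M} {V W : Set 𝒢.OrbitSpace} {f : 𝒢.OrbitSpace → ℝ}
    (h : 𝒢.IsPrimitiveOn η W f) (hVW : V ⊆ W) : 𝒢.IsPrimitiveOn η V f :=
  ⟨h.1.mono (preimage_mono hVW), fun x hx => h.2 x (hVW hx)⟩

theorem IsPrimitiveOn.mdifferentiableAt {η : OneForm E M} {V : Set 𝒢.OrbitSpace}
    {f : 𝒢.OrbitSpace → ℝ} (h : 𝒢.IsPrimitiveOn η V f) (hV : IsOpen V) {x : M}
    (hx : 𝒢.proj x ∈ V) : MDifferentiableAt 𝓘(ℝ, E) 𝓘(ℝ, ℝ) (f ∘ 𝒢.proj) x :=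
  (h.1.contMDiffAt ((hV.preimage continuous_proj).mem_nhds hx)).mdifferentiableAt (by simp)

theorem IsPrimitiveOn.add {η θ : OneForm E M} {V : Set 𝒢.OrbitSpace} (hV : IsOpen V)
    {f f' : 𝒢.OrbitSpace → ℝ} (h : 𝒢.IsPrimitiveOn η V f) (h' : 𝒢.IsPrimitiveOn θ V f') :
    𝒢.IsPrimitiveOn (η + θ) V (f + f') := by
  refine ⟨h.1.add h'.1, fun x hx w => ?_⟩
  have e := ((h.mdifferentiableAt hV hx).hasMFDerivAt.add
    (h'.mdifferentiableAt hV hx).hasMFDerivAt).mfderiv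
  refine (congrArg (fun A => A w) e).trans ?_
  exact congrArg₂ (· + ·) (h.2 x hx w) (h'.2 x hx w)

theorem IsPrimitiveOn.smul {η : OneForm E M} {V : Set 𝒢.OrbitSpace} (hV : IsOpen V) (r : ℝ)
    {f : 𝒢.OrbitSpace → ℝ} (h : 𝒢.IsPrimitiveOn η V f) :
    𝒢.IsPrimitiveOn (r • η) V (r • f) := by
  refine ⟨(contMDiffOn_const (c := r)).mul h.1, fun x hx w => ?_⟩
  have e := ((h.mdifferentiableAt hV hx).hasMFDerivAt.const_smul r).mfderiv
  refine (congrArg (fun A => A w) e).trans ?_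
  exact congrArg (r * ·) (h.2 x hx w)

theorem isPrimitiveOn_zero (V : Set 𝒢.OrbitSpace) :
    𝒢.IsPrimitiveOn (0 : OneForm E M) V 0 := by
  refine ⟨contMDiffOn_const, fun x _ w => ?_⟩
  exact (congrArg (fun A => A w) (hasMFDerivAt_const (I := 𝓘(ℝ, E)) (I' := 𝓘(ℝ, ℝ)) (0 : ℝ) x).mfderiv)

theorem IsPrimitiveOn.sub {η θ : OneForm E M} {V : Set 𝒢.OrbitSpace} (hV : IsOpen V)
    {f f' : 𝒢.OrbitSpace → ℝ} (h : 𝒢.IsPrimitiveOn η V f) (h' : 𝒢.IsPrimitiveOn θ V f') :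
    𝒢.IsPrimitiveOn (η - θ) V (f - f') := by
  have := h.add hV (h'.smul hV (-1))
  rwa [neg_one_smul ℝ θ, neg_one_smul ℝ f', ← sub_eq_add_neg, ← sub_eq_add_neg] at this

theorem IsPrimitiveOn.locConstOn {V : Set 𝒢.OrbitSpace} (hV : IsOpen V) {f : 𝒢.OrbitSpace → ℝ}
    (h : 𝒢.IsPrimitiveOn (0 : OneForm E M) V f) : Cech.LocConstOn f V := by
  intro p hp
  obtain ⟨x, rfl⟩ := proj_surjective p
  have := locConstOn_of_dAt_eq_zero (hV.preimage continuous_proj) h.1 h.2 x hp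
  have := (isOpenMap_proj (𝒢 := 𝒢)).image_mem_nhds this
  filter_upwards [this]
  rintro _ ⟨y, hy, rfl⟩
  exact hy

theorem IsBasic.exists_isPrimitiveOn [IsManifold 𝓘(ℝ, E) ∞ G] {η : OneForm E M} (hb : 𝒢.IsBasic η) (hη : η.IsClosed)
    (p : 𝒢.OrbitSpace) :
    ∃ (V : Set 𝒢.OrbitSpace) (f : 𝒢.OrbitSpace → ℝ), IsOpen V ∧ p ∈ V ∧
      𝒢.IsPrimitiveOn η V f := by
  obtain ⟨x, rfl⟩ := proj_surjective p
  obtain ⟨V₀, f₀, hV₀, hx₀, hf₀, hd₀⟩ := hη.exists_primitive x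
  have hs := 𝒢.contMDiff_src
  have ht := 𝒢.contMDiff_tgt
  have md : ∀ y ∈ V₀, MDifferentiableAt 𝓘(ℝ, E) 𝓘(ℝ, ℝ) f₀ y := fun y hy =>
    (hf₀.contMDiffAt (hV₀.mem_nhds hy)).mdifferentiableAt (by simp)
  set O : Set G := 𝒢.src ⁻¹' V₀ ∩ 𝒢.tgt ⁻¹' V₀ with hO
  have hOo : IsOpen O := (hV₀.preimage hs.continuous).inter (hV₀.preimage ht.continuous)
  set h : G → ℝ := f₀ ∘ 𝒢.tgt - f₀ ∘ 𝒢.src with hh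
  have hloc : ∀ g ∈ O, ∀ᶠ g' in 𝓝 g, h g' = h g := by
    refine locConstOn_of_dAt_eq_zero (E := E) (M := G) hOo ?_ ?_
    · exact (hf₀.comp ht.contMDiffOn fun g hg => hg.2).sub
        (hf₀.comp hs.contMDiffOn fun g hg => hg.1)
    · rintro g ⟨hg1, hg2⟩ w
      have e := (((md _ hg2).hasMFDerivAt.comp g
        ((ht g).mdifferentiableAt (by simp)).hasMFDerivAt).sub
        ((md _ hg1).hasMFDerivAt.comp g
        ((hs g).mdifferentiableAt (by simp)).hasMFDerivAt)).mfderiv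
      refine (congrArg (fun A => A w) e).trans ?_
      have e1 := hd₀ _ hg2 (mfderiv 𝓘(ℝ, E) 𝓘(ℝ, E) 𝒢.tgt g w)
      have e2 := hd₀ _ hg1 (mfderiv 𝓘(ℝ, E) 𝓘(ℝ, E) 𝒢.src g w)
      exact sub_eq_zero.2 (e1.trans ((hb g w).trans e2.symm))
  set W : Set G := {g | g ∈ O ∧ h g = 0} with hW
  have hWo : IsOpen W := by
    rw [isOpen_iff_mem_nhds]
    rintro g ⟨hg, hg0⟩
    filter_upwards [hOo.mem_nhds hg, hloc g hg] with g' h1 h2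
    exact ⟨h1, h2.trans hg0⟩
  have hC : IsClosed ((fun g => (𝒢.src g, 𝒢.tgt g)) '' Wᶜ) :=
    𝒢.proper.isClosedMap _ hWo.isClosed_compl
  have hxC : (x, x) ∈ ((fun g => (𝒢.src g, 𝒢.tgt g)) '' Wᶜ)ᶜ := by
    rintro ⟨g, hg, hgx⟩
    simp only [Prod.mk.injEq] at hgx
    refine hg ⟨⟨?_, ?_⟩, ?_⟩
    · simpa [hgx.1] using hx₀
    · simpa [hgx.2] using hx₀
    · simp [hh, hgx.1, hgx.2]
  obtain ⟨A, B, hA, hB, hxA, hxB, hAB⟩ := isOpen_prod_iff.1 hC.isOpen_compl x x hxC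
  set V₁ : Set M := A ∩ B ∩ V₀ with hV₁
  have hV₁o : IsOpen V₁ := (hA.inter hB).inter hV₀
  have hinv : ∀ g, 𝒢.src g ∈ V₁ → 𝒢.tgt g ∈ V₁ → f₀ (𝒢.tgt g) = f₀ (𝒢.src g) := by
    intro g h1 h2
    have : g ∈ W := by
      by_contra hg
      exact hAB (mk_mem_prod h1.1.1 h2.1.2) ⟨g, hg, rfl⟩
    have := this.2
    simp only [hh, Pi.sub_apply, Function.comp] at this
    linarith
  classical
  let F : 𝒢.OrbitSpace → ℝ := fun q =>
    if hq : ∃ y ∈ V₁, 𝒢.proj y = q then f₀ hq.choose else 0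
  have hF : ∀ y ∈ V₁, F (𝒢.proj y) = f₀ y := by
    intro y hy
    have hq : ∃ y' ∈ V₁, 𝒢.proj y' = 𝒢.proj y := ⟨y, hy, rfl⟩
    simp only [F, dif_pos hq]
    obtain ⟨g, hg1, hg2⟩ := proj_eq_iff.1 hq.choose_spec.2
    have := hinv g (by rw [hg1]; exact hq.choose_spec.1) (by rw [hg2]; exact hy)
    rw [hg1, hg2] at this
    exact this.symm
  have hFV : ∀ y ∈ V₁, F ∘ 𝒢.proj =ᶠ[𝓝 y] f₀ := fun y hy => by
    filter_upwards [hV₁o.mem_nhds hy] with z hz using hF z hz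
  have hFs : ∀ y ∈ V₁, ContMDiffAt 𝓘(ℝ, E) 𝓘(ℝ, ℝ) ∞ (F ∘ 𝒢.proj) y := fun y hy =>
    (hf₀.contMDiffAt (hV₀.mem_nhds hy.2)).congr_of_eventuallyEq (hFV y hy)
  have hFd : ∀ y ∈ V₁, ∀ w : TangentSpace 𝓘(ℝ, E) y, dAt (F ∘ 𝒢.proj) y w = η.eval y w := by
    intro y hy w
    refine Eq.trans ?_ (hd₀ y hy.2 w)
    exact congrArg (fun A : E →L[ℝ] ℝ => A w) (hFV y hy).mfderiv_eq
  have hst : F ∘ 𝒢.proj ∘ 𝒢.tgt = F ∘ 𝒢.proj ∘ 𝒢.src := funext fun g =>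
    congrArg F (proj_src g).symm
  have hsm : ∀ g, 𝒢.src g ∈ V₁ → ContMDiffAt 𝓘(ℝ, E) 𝓘(ℝ, ℝ) ∞ (F ∘ 𝒢.proj) (𝒢.tgt g) := by
    intro g hg
    have hl := 𝒢.isLocalDiffeomorph_tgt g
    have h1 : ContMDiffAt 𝓘(ℝ, E) 𝓘(ℝ, ℝ) ∞ (F ∘ 𝒢.proj ∘ 𝒢.tgt) g := by
      rw [hst]
      exact (hFs _ hg).comp g (hs g)
    have hlg : hl.localInverse (𝒢.tgt g) = g := hl.localInverse_left_inv hl.localInverse_mem_target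
    have h2 : ContMDiffAt 𝓘(ℝ, E) 𝓘(ℝ, ℝ) ∞ ((F ∘ 𝒢.proj ∘ 𝒢.tgt) ∘ hl.localInverse)
        (𝒢.tgt g) :=
      ContMDiffAt.comp (𝒢.tgt g) (by rw [hlg]; exact h1) hl.localInverse_contMDiffAt
    refine h2.congr_of_eventuallyEq ?_
    filter_upwards [hl.localInverse_eventuallyEq_right] with z hz
    simp only [Function.comp, id] at hz ⊢
    rw [hz]
  refine ⟨𝒢.proj '' V₁, F, isOpenMap_proj _ hV₁o, ⟨x, ⟨⟨hxA, hxB⟩, hx₀⟩, rfl⟩, ?_, ?_⟩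
  · rintro y ⟨z, hz, hzy⟩
    obtain ⟨g, rfl, rfl⟩ := proj_eq_iff.1 hzy
    exact (hsm g hz).contMDiffWithinAt
  · rintro y ⟨z, hz, hzy⟩ w
    obtain ⟨g, rfl, rfl⟩ := proj_eq_iff.1 hzy
    have hl := 𝒢.isLocalDiffeomorph_tgt g
    obtain ⟨w', rfl⟩ := (hl.mfderivToContinuousLinearEquiv (by simp)).surjective w
    have e1 := (((hsm g hz).mdifferentiableAt (by simp)).hasMFDerivAt.comp g
        ((ht g).mdifferentiableAt (by simp)).hasMFDerivAt).mfderiv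
    have e2 := (((hFs _ hz).mdifferentiableAt (by simp)).hasMFDerivAt.comp g
        ((hs g).mdifferentiableAt (by simp)).hasMFDerivAt).mfderiv
    have e3 : mfderiv 𝓘(ℝ, E) 𝓘(ℝ, ℝ) ((F ∘ 𝒢.proj) ∘ 𝒢.tgt) g w' =
      mfderiv 𝓘(ℝ, E) 𝓘(ℝ, ℝ) ((F ∘ 𝒢.proj) ∘ 𝒢.src) g w' := by
      have : (F ∘ 𝒢.proj) ∘ 𝒢.tgt = (F ∘ 𝒢.proj) ∘ 𝒢.src := hst
      rw [this]
    have e4 := hFd _ hz (mfderiv 𝓘(ℝ, E) 𝓘(ℝ, E) 𝒢.src g w')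
    have e5 := (hb g w').symm
    exact ((congrArg (fun A => A w') e1).symm.trans (e3.trans (congrArg (fun A => A w') e2))).trans
      (e4.trans e5)


variable (𝒢) in
/-- The 1-forms `df`, for smooth functions `f` on `X`, i.e. for smooth basic functions on `M`. -/
def exactForms : Submodule ℝ (OneForm E M) where
  carrier := {η | ∃ f, 𝒢.IsPrimitiveOn η univ f}
  zero_mem' := ⟨0, isPrimitiveOn_zero univ⟩
  add_mem' := by
    rintro η θ ⟨f, hf⟩ ⟨f', hf'⟩
    exact ⟨f + f', hf.add isOpen_univ hf'⟩
  smul_mem' := by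
    rintro r η ⟨f, hf⟩
    exact ⟨r • f, hf.smul isOpen_univ r⟩

/-- The first basic (de Rham) cohomology `H¹(X)`: closed basic 1-forms modulo differentials of
smooth basic functions. -/
abbrev DeRhamH1 (𝒢 : ProperEtaleGroupoid E M G) : Type _ :=
  𝒢.closedBasic ⧸ 𝒢.exactForms.submoduleOf 𝒢.closedBasic

/-- The cohomology class of a closed basic 1-form. -/
def classOf (η : 𝒢.closedBasic) : 𝒢.DeRhamH1 := Submodule.Quotient.mk η

variable (𝒢) in
/-- The real homology `H₁(X, ℝ)`, as the dual of the first cohomology `H¹(X)`; the pairing `⟨ξ, A⟩`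
of `ξ` in `H¹(X)` and `A` in `H₁(X, ℝ)` is the evaluation `A ξ`. -/
abbrev RealHomology1 : Type _ := Module.Dual ℝ 𝒢.DeRhamH1

/-! ### The Čech class of a de Rham class -/

section CechClass

theorem isCocycle_of_isPrimitiveOn {η : OneForm E M} {U : Cech.PointedCover 𝒢.OrbitSpace}
    {f : 𝒢.OrbitSpace → 𝒢.OrbitSpace → ℝ} (h : ∀ p, 𝒢.IsPrimitiveOn η (U.set p) (f p)) :
    Cech.IsCocycle U (fun a b z => f b z - f a z) := by
  refine ⟨fun a b => ?_, fun a b d z _ => by ring⟩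
  have hV := (U.isOpen a).inter (U.isOpen b)
  have := ((h b).mono inter_subset_right).sub hV ((h a).mono inter_subset_left)
  rw [sub_self] at this
  exact this.locConstOn hV

variable [IsManifold 𝓘(ℝ, E) ∞ G]

theorem exists_primitives (η : 𝒢.closedBasic) :
    ∃ (U : Cech.PointedCover 𝒢.OrbitSpace) (f : 𝒢.OrbitSpace → 𝒢.OrbitSpace → ℝ),
      ∀ p, 𝒢.IsPrimitiveOn η.1 (U.set p) (f p) := by
  choose U f hU hm hf using fun p => η.2.1.exists_isPrimitiveOn η.2.2 p
  exact ⟨⟨U, hU, hm⟩, f, hf⟩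

/-- An open cover of `X` such that `η` is exact on its members. -/
def primitiveCover (η : 𝒢.closedBasic) : Cech.PointedCover 𝒢.OrbitSpace :=
  (exists_primitives η).choose

/-- Primitives of `η` on the members of the open cover `primitiveCover η`. -/
def primitive (η : 𝒢.closedBasic) : 𝒢.OrbitSpace → 𝒢.OrbitSpace → ℝ :=
  (exists_primitives η).choose_spec.choose

theorem isPrimitiveOn_primitive (η : 𝒢.closedBasic) (p : 𝒢.OrbitSpace) :
    𝒢.IsPrimitiveOn η.1 ((primitiveCover η).set p) (primitive η p) :=
  (exists_primitives η).choose_spec.choose_spec p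

/-- The Čech cocycle `f_b - f_a` of the chosen local primitives `f_a` of `η`. -/
def cechCocycle (η : 𝒢.closedBasic) : Cech.cocycles 𝒢.OrbitSpace :=
  ⟨fun a b z => primitive η b z - primitive η a z, primitiveCover η,
    isCocycle_of_isPrimitiveOn (isPrimitiveOn_primitive η)⟩

/-- The Čech class of the cocycle of local primitives of a closed basic 1-form. -/
def cechClassOfForm : 𝒢.closedBasic →ₗ[ℝ] Cech.H1 𝒢.OrbitSpace where
  toFun η := Submodule.Quotient.mk (cechCocycle η)
  map_add' η θ := by
    rw [← Submodule.Quotient.mk_add, Submodule.Quotient.eq]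
    let W := (primitiveCover (η + θ)).inf ((primitiveCover η).inf (primitiveCover θ))
    refine ⟨W, fun a => primitive (η + θ) a - (primitive η a + primitive θ a), fun a => ?_,
      fun a a' z _ => ?_⟩
    · have h := ((isPrimitiveOn_primitive (η + θ) a).mono
        (V := W.set a) (fun _ hz => hz.1)).sub (W.isOpen a)
        (((isPrimitiveOn_primitive η a).mono (V := W.set a) (fun _ hz => hz.2.1)).add (W.isOpen a)
          ((isPrimitiveOn_primitive θ a).mono (V := W.set a) (fun _ hz => hz.2.2)))
      rw [Submodule.coe_add, sub_self] at h
      exact h.locConstOn (W.isOpen a)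
    · change (primitive (η + θ) a' z - primitive (η + θ) a z) -
        ((primitive η a' z - primitive η a z) + (primitive θ a' z - primitive θ a z)) =
        (primitive (η + θ) a' z - (primitive η a' z + primitive θ a' z)) -
        (primitive (η + θ) a z - (primitive η a z + primitive θ a z))
      ring
  map_smul' r η := by
    rw [RingHom.id_apply, ← Submodule.Quotient.mk_smul, Submodule.Quotient.eq]
    let W := (primitiveCover (r • η)).inf (primitiveCover η)
    refine ⟨W, fun a => primitive (r • η) a - r • primitive η a, fun a => ?_,
      fun a a' z _ => ?_⟩
    · have h := ((isPrimitiveOn_primitive (r • η) a).mono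
        (V := W.set a) (fun _ hz => hz.1)).sub (W.isOpen a)
        (((isPrimitiveOn_primitive η a).mono (V := W.set a) (fun _ hz => hz.2)).smul
          (W.isOpen a) r)
      rw [Submodule.coe_smul, sub_self] at h
      exact h.locConstOn (W.isOpen a)
    · change (primitive (r • η) a' z - primitive (r • η) a z) -
        r * (primitive η a' z - primitive η a z) =
        (primitive (r • η) a' z - r * primitive η a' z) -
        (primitive (r • η) a z - r * primitive η a z)
      ring

/-- The comparison map `H¹(X) → Ȟ¹(X, ℝ)`: the class of a closed form with the local primitives
`f_a` goes to the class of the cocycle `f_b - f_a`. -/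
def cechClass : 𝒢.DeRhamH1 →ₗ[ℝ] Cech.H1 𝒢.OrbitSpace :=
  Submodule.liftQ _ cechClassOfForm (by
    rintro η ⟨f, hf⟩
    rw [LinearMap.mem_ker]
    refine (Submodule.Quotient.mk_eq_zero _).2 ?_
    refine ⟨primitiveCover η, fun a => primitive η a - f, fun a => ?_, fun a a' z _ => ?_⟩
    · have h := (isPrimitiveOn_primitive η a).sub ((primitiveCover η).isOpen a)
        (hf.mono (subset_univ _))
      rw [Submodule.subtype_apply, sub_self] at h
      exact h.locConstOn ((primitiveCover η).isOpen a)
    · change primitive η a' z - primitive η a z =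
        (primitive η a' z - f z) - (primitive η a z - f z)
      ring)

/-- The restriction `ξ|_Y ∈ Ȟ¹(Y, ℝ)` of `ξ ∈ H¹(X)` to a subspace `Y` of `X`. -/
def cechRestriction (ξ : 𝒢.DeRhamH1) (Y : Set 𝒢.OrbitSpace) : Cech.H1 Y :=
  Cech.H1.map ⟨Subtype.val, continuous_subtype_val⟩ (cechClass ξ)

end CechClass

/-! ### Vector fields, flows, invariant measures, asymptotic cycles -/

variable [IsManifold 𝓘(ℝ, E) ∞ G]

/-- A vector field on `X`, given by a basic vector field: vector fields on `G` and on `M` that are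
related by the source and the target maps. (As the groupoid is étale, the kernels of `ds` and of `dt`
vanish, so that there is no further identification to make among such pairs.) -/
structure BasicVectorField (𝒢 : ProperEtaleGroupoid E M G) where
  /-- the vector field on `G` -/
  onArrows : VectorField E G
  /-- the vector field on `M` -/
  onObjects : VectorField E M
  map_src : ∀ g, mfderiv 𝓘(ℝ, E) 𝓘(ℝ, E) 𝒢.src g (onArrows g) = onObjects (𝒢.src g)
  map_tgt : ∀ g, mfderiv 𝓘(ℝ, E) 𝓘(ℝ, E) 𝒢.tgt g (onArrows g) = onObjects (𝒢.tgt g)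

namespace BasicVectorField

variable (v : BasicVectorField 𝒢)

/-- The contraction `ι_v η`, as a function on `X`. -/
def contraction (η : 𝒢.closedBasic) : 𝒢.OrbitSpace → ℝ :=
  Quotient.lift (fun x => η.1.eval x (v.onObjects x)) (by
    rintro _ _ ⟨g, rfl, rfl⟩
    have := η.2.1 g (v.onArrows g)
    rw [v.map_src, v.map_tgt] at this
    exact this.symm)

theorem contraction_proj (η : 𝒢.closedBasic) (x : M) :
    v.contraction η (𝒢.proj x) = η.1.eval x (v.onObjects x) := rfl

theorem continuous_contraction (η : 𝒢.closedBasic) : Continuous (v.contraction η) := by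
  have h : ContMDiff 𝓘(ℝ, E) (𝓘(ℝ, E).prod 𝓘(ℝ, ℝ)) ∞
      (fun x => Bundle.TotalSpace.mk' ℝ (E := Bundle.Trivial M ℝ) x (η.1 x (v.onObjects x))) :=
    ContMDiff.clm_bundle_apply η.1.contMDiff v.onObjects.contMDiff
  have h2 : Continuous fun x => η.1.eval x (v.onObjects x) := by
    refine continuous_iff_continuousAt.2 fun x => ?_
    exact ((Bundle.contMDiffAt_section x).1 (h x)).continuousAt
  exact continuous_quot_lift _ h2

/-- The flow `Φ` on `X` is generated by `v`: it is covered by the local flow of the vector field on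
`M`, that is, the integral curves of the latter are mapped to trajectories of `Φ` by the projection
`M → X`. (The local flow on `M` need not be complete.) -/
def Generates (Φ : Flow ℝ 𝒢.OrbitSpace) : Prop :=
  ∀ (γ : ℝ → M) (ε : ℝ), IsMIntegralCurveOn γ v.onObjects (Ioo (-ε) ε) →
    ∀ t ∈ Ioo (-ε) ε, Φ t (𝒢.proj (γ 0)) = 𝒢.proj (γ t)

/-- If the vector field on `M` has a global flow that covers `Φ`, then `v` generates `Φ`. -/
theorem generates_of_global_flow [T2Space M] (Φ : Flow ℝ 𝒢.OrbitSpace) (φ : ℝ → M → M)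
    (h0 : ∀ x, φ 0 x = x) (hφ : ∀ x, IsMIntegralCurve (fun t => φ t x) v.onObjects)
    (hcov : ∀ t x, Φ t (𝒢.proj x) = 𝒢.proj (φ t x)) : v.Generates Φ := by
  intro γ ε hγ t ht
  have hε : 0 < ε := by linarith [ht.1, ht.2]
  have h := isMIntegralCurveOn_Ioo_eqOn_of_contMDiff_boundaryless (I := 𝓘(ℝ, E)) (t₀ := 0)
    ⟨neg_lt_zero.2 hε, hε⟩ (v.onObjects.contMDiff.of_le (by simp)) hγ
    ((hφ (γ 0)).isMIntegralCurveOn _) (h0 _).symm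
  rw [hcov, h ht]

/-- The closed 1-form `η` on `X` is a Lyapunov 1-form for the vector field `v` and the subset `Y`
of `X`: the function `ι_v η` is negative on `X - Y`, and on an open neighbourhood `V` of `Y` one has
`η = df` for a smooth function `f` on `V` whose differential vanishes at the points of `Y`. -/
structure IsLyapunov (Y : Set 𝒢.OrbitSpace) (η : 𝒢.closedBasic) : Prop where
  neg : ∀ p ∉ Y, v.contraction η p < 0
  exists_primitive : ∃ (V : Set 𝒢.OrbitSpace) (f : 𝒢.OrbitSpace → ℝ), IsOpen V ∧ Y ⊆ V ∧
    𝒢.IsPrimitiveOn η.1 V f ∧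
    ∀ x, 𝒢.proj x ∈ Y → ∀ w : TangentSpace 𝓘(ℝ, E) x, dAt (f ∘ 𝒢.proj) x w = 0

variable {v}

theorem Generates.hasDerivAt [CompleteSpace E] {Φ : Flow ℝ 𝒢.OrbitSpace}
    (hΦ : v.Generates Φ) (η : 𝒢.closedBasic)
    {f : 𝒢.OrbitSpace → ℝ} (hf : 𝒢.IsPrimitiveOn η.1 univ f) (p : 𝒢.OrbitSpace) (s : ℝ) :
    HasDerivAt (fun t => f (Φ t p)) (v.contraction η (Φ s p)) s := by
  have key : ∀ q, HasDerivAt (fun t => f (Φ t q)) (v.contraction η q) 0 := by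
    intro q
    obtain ⟨x, rfl⟩ := proj_surjective q
    obtain ⟨γ, rfl, hγ⟩ := exists_isMIntegralCurveAt_of_contMDiffAt_boundaryless (I := 𝓘(ℝ, E)) 0
      ((v.onObjects.contMDiff x).of_le (by simp))
    obtain ⟨ε, hε, hγε⟩ := isMIntegralCurveAt_iff'.1 hγ
    rw [Real.ball_eq_Ioo, zero_sub, zero_add] at hγε
    have h0 : HasMFDerivAt 𝓘(ℝ, ℝ) 𝓘(ℝ, E) γ 0
        ((1 : ℝ →L[ℝ] ℝ).smulRight (v.onObjects (γ 0))) := hγ.self_of_nhds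
    have h1 := (hf.mdifferentiableAt isOpen_univ (mem_univ (𝒢.proj (γ 0)))).hasMFDerivAt.comp 0 h0
    rw [hasMFDerivAt_iff_hasFDerivAt] at h1
    obtain ⟨A, hA, hA1⟩ : ∃ A : ℝ →L[ℝ] ℝ, HasFDerivAt ((f ∘ 𝒢.proj) ∘ γ) A 0 ∧
        A 1 = v.contraction η (𝒢.proj (γ 0)) := by
      refine ⟨_, h1, ?_⟩
      rw [contraction_proj, ← hf.2 (γ 0) (mem_univ _)]
      change mfderiv 𝓘(ℝ, E) 𝓘(ℝ, ℝ) (f ∘ 𝒢.proj) (γ 0) ((1 : ℝ) • v.onObjects (γ 0)) = _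
      rw [one_smul]
      rfl
    have h3 : HasDerivAt ((f ∘ 𝒢.proj) ∘ γ) (v.contraction η (𝒢.proj (γ 0))) 0 :=
      hA1 ▸ hA.hasDerivAt
    refine h3.congr_of_eventuallyEq ?_
    filter_upwards [Ioo_mem_nhds (neg_lt_zero.2 hε) hε] with t ht
    exact congrArg f (hΦ γ ε hγε t ht)
  have h := key (Φ s p)
  have h' : HasDerivAt (fun t => f (Φ (t - s) (Φ s p))) (v.contraction η (Φ s p)) s :=
    HasDerivAt.comp_sub_const s s (f := fun t => f (Φ t (Φ s p))) (by simpa using h)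
  refine h'.congr_of_eventuallyEq (Eventually.of_forall fun t => ?_)
  simp only [← Φ.map_add, sub_add_cancel]

end BasicVectorField

/-- A positive measure on `X` that is invariant under the flow `Φ`. On a compact `X`, measures in the
sense of positive linear functionals on the continuous functions are the finite Borel measures. -/
structure InvariantMeasure (Φ : Flow ℝ 𝒢.OrbitSpace) where
  /-- the measure -/
  toMeasure : Measure 𝒢.OrbitSpace
  isFinite : IsFiniteMeasure toMeasure
  map_eq : ∀ t, toMeasure.map (Φ t) = toMeasure

variable [CompactSpace 𝒢.OrbitSpace]

theorem integrable_of_continuous (μ : Measure 𝒢.OrbitSpace) [IsFiniteMeasure μ]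
    {h : 𝒢.OrbitSpace → ℝ} (hh : Continuous h) : Integrable h μ := by
  obtain ⟨C, hC⟩ := isCompact_univ.exists_bound_of_continuousOn hh.continuousOn
  exact Integrable.of_bound hh.aestronglyMeasurable C
    (Eventually.of_forall fun p => hC p (mem_univ p))

variable [CompleteSpace E] {v : BasicVectorField 𝒢} {Φ : Flow ℝ 𝒢.OrbitSpace}

theorem integral_contraction_eq_zero (hΦ : v.Generates Φ) (μ : InvariantMeasure Φ)
    (η : 𝒢.closedBasic) {f : 𝒢.OrbitSpace → ℝ} (hf : 𝒢.IsPrimitiveOn η.1 univ f) :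
    ∫ p, v.contraction η p ∂μ.toMeasure = 0 := by
  have := μ.isFinite
  have hfc : Continuous f := by
    have : Continuous (f ∘ 𝒢.proj) := by
      have := hf.1.continuousOn
      rwa [preimage_univ, continuousOn_univ] at this
    exact (isQuotientMap_quotient_mk' (s := 𝒢.orbitRel)).continuous_iff.2 this
  obtain ⟨C, hC⟩ := isCompact_univ.exists_bound_of_continuousOn
    (v.continuous_contraction η).continuousOn
  have hΦc : ∀ t, Continuous (Φ t) := fun t => Φ.continuous_toFun t
  have hd := (hasDerivAt_integral_of_dominated_loc_of_deriv_le (μ := μ.toMeasure)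
    (F := fun t p => f (Φ t p)) (F' := fun t p => v.contraction η (Φ t p)) (x₀ := (0 : ℝ))
    (s := univ) (bound := fun _ => C) univ_mem
    (Eventually.of_forall fun t => (hfc.comp (hΦc t)).aestronglyMeasurable)
    (integrable_of_continuous _ (hfc.comp (hΦc 0)))
    ((v.continuous_contraction η).comp (hΦc 0)).aestronglyMeasurable
    (Eventually.of_forall fun p t _ => hC _ (mem_univ _))
    (integrable_const C)
    (Eventually.of_forall fun p t _ => hΦ.hasDerivAt η hf p t)).2
  have hconst : (fun t => ∫ p, f (Φ t p) ∂μ.toMeasure) = fun _ => ∫ p, f p ∂μ.toMeasure := by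
    funext t
    have h := integral_map (μ := μ.toMeasure) (hΦc t).measurable.aemeasurable (f := f)
      hfc.aestronglyMeasurable
    rw [μ.map_eq t] at h
    exact h.symm
  rw [hconst] at hd
  have := hd.unique (hasDerivAt_const _ _)
  simpa using this

/-- The asymptotic cycle `A_μ ∈ H₁(X, ℝ)` of the flow `Φ` generated by `v` and of the invariant
measure `μ`: the homology class with `⟨[η], A_μ⟩ = ∫_X ι_v η dμ` for every closed 1-form `η`. -/
def asymptoticCycle (hΦ : v.Generates Φ) (μ : InvariantMeasure Φ) : 𝒢.RealHomology1 :=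
  Submodule.liftQ _
    { toFun := fun η => ∫ p, v.contraction η p ∂μ.toMeasure
      map_add' := fun η θ => by
        have := μ.isFinite
        rw [← integral_add (integrable_of_continuous _ (v.continuous_contraction η))
          (integrable_of_continuous _ (v.continuous_contraction θ))]
        refine integral_congr_ae (Eventually.of_forall fun p => ?_)
        obtain ⟨x, rfl⟩ := proj_surjective p
        rfl
      map_smul' := fun r η => by
        rw [RingHom.id_apply, smul_eq_mul, ← integral_const_mul]
        refine integral_congr_ae (Eventually.of_forall fun p => ?_)
        obtain ⟨x, rfl⟩ := proj_surjective p
        rfl }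
    (by
      rintro η ⟨f, hf⟩
      exact integral_contraction_eq_zero hΦ μ η hf)

theorem asymptoticCycle_classOf (hΦ : v.Generates Φ) (μ : InvariantMeasure Φ) (η : 𝒢.closedBasic) :
    asymptoticCycle hΦ μ (classOf η) = ∫ p, v.contraction η p ∂μ.toMeasure := rfl

end ProperEtaleGroupoid
end

/-! Fix a Lyapunov form `η` representing `ξ`. Both conclusions are read off from this single
representative.

Pairing with asymptotic cycles. By construction the pairing of `[η]` with the asymptotic cycle of
`μ` is the integral of the function `ι_v η`. The invariance of `μ` is what makes this integral
depend on the class alone; it was spent when `asymptoticCycle` was shown to descend to the quotient.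
So any representative may be used, and a Lyapunov form has an integrand with a sign: `ι_v η` is
negative off `Y`, and on `Y` it equals `df(v)`, which vanishes because `df` does. Hence `ι_v η ≤ 0`
with zero set exactly `Y` (`IsLyapunov.contraction_eq_zero_iff`). The integral of such a function is
nonpositive. As `ι_v η` is continuous on a compact space, it is integrable for a finite measure, so
the integral vanishes only if `ι_v η = 0` almost everywhere, that is, only if the complement of `Y`
is a null set (`IsLyapunov.integral_eq_zero_iff`).

Čech restriction. Let `f_a` be the local primitives of `η` that define its Čech cocycle `f_b - f_a`,
and let `f` be the primitive on a neighbourhood of `Y`. Each `f_a - f` is locally constant where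
both functions are primitives, in particular near every point of `Y` in the domain of `f_a`. Since
`f_b - f_a = (f_b - f) - (f_a - f)`, the cocycle becomes a coboundary after restriction to `Y`
(`cechRestriction_classOf_eq_zero`). -/

namespace ProperEtaleGroupoid

variable {E : Type*} [NormedAddCommGroup E] [NormedSpace ℝ E]
  {M : Type*} [TopologicalSpace M] [ChartedSpace E M] [IsManifold 𝓘(ℝ, E) ∞ M]
  {G : Type*} [TopologicalSpace G] [ChartedSpace E G] [IsManifold 𝓘(ℝ, E) ∞ G]
  {𝒢 : ProperEtaleGroupoid E M G}

/-! ### Vanishing of the Čech restriction -/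

/-- A closed 1-form that is exact on a neighbourhood of `Y` has vanishing Čech restriction
to `Y`. -/
theorem cechRestriction_classOf_eq_zero {η : 𝒢.closedBasic} {V Y : Set 𝒢.OrbitSpace}
    {f : 𝒢.OrbitSpace → ℝ} (hV : IsOpen V) (hYV : Y ⊆ V) (hf : 𝒢.IsPrimitiveOn η.1 V f) :
    cechRestriction (classOf η) Y = 0 := by
  -- Both the comparison map and the restriction act on representatives, so the class is by
  -- definition that of the cocycle `f_b - f_a` evaluated at points of `Y`.
  refine (Submodule.Quotient.mk_eq_zero _).2 ?_
  -- The traces on `Y` of the cover by domains of primitives suffice, with the 0-cochain `f_a - f`.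
  -- The cover need not be shrunk to fit inside `V`, because every point of `Y` already lies in `V`.
  refine ⟨(primitiveCover η).pullback ⟨Subtype.val, continuous_subtype_val⟩,
    fun a z => primitive η a z - f z, fun a z hz => ?_, fun a a' z _ => ?_⟩
  · have hW := ((primitiveCover η).isOpen a).inter hV
    have h := ((isPrimitiveOn_primitive η a).mono inter_subset_left).sub hW
      (hf.mono inter_subset_right)
    -- On the overlap with `V`, the difference `f_a - f` is a primitive of `η - η = 0`, hence
    -- locally constant there.
    rw [sub_self] at h
    -- Local constancy holds on an open subset of `X`; continuity of the inclusion carries it to the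
    -- subspace topology of `Y`.
    exact continuous_subtype_val.continuousAt.eventually
      (h.locConstOn hW z ⟨hz, hYV z.2⟩)
  · change primitive η a' z - primitive η a z =
      (primitive η a' z - f z) - (primitive η a z - f z)
    ring

/-! ### Sign and zero set of `ι_v η`, and its integrals -/

namespace BasicVectorField

variable {v : BasicVectorField 𝒢} {Y : Set 𝒢.OrbitSpace} {η : 𝒢.closedBasic}

/-- At a point of `M` above `p`, the primitive near `Y` gives `η(v) = df(v)`, and `df` vanishes over
`Y`. This is where the second half of the Lyapunov condition (2) enters. -/
theorem IsLyapunov.contraction_eq_zero (h : v.IsLyapunov Y η) {p : 𝒢.OrbitSpace} (hp : p ∈ Y) :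
    v.contraction η p = 0 := by
  obtain ⟨V, f, -, hYV, hf, h0⟩ := h.exists_primitive
  obtain ⟨x, rfl⟩ := proj_surjective p
  rw [contraction_proj, ← hf.2 x (hYV hp), h0 x hp]

theorem IsLyapunov.contraction_nonpos (h : v.IsLyapunov Y η) (p : 𝒢.OrbitSpace) :
    v.contraction η p ≤ 0 := by
  by_cases hp : p ∈ Y
  · exact (h.contraction_eq_zero hp).le
  · exact (h.neg p hp).le

theorem IsLyapunov.contraction_eq_zero_iff (h : v.IsLyapunov Y η) {p : 𝒢.OrbitSpace} :
    v.contraction η p = 0 ↔ p ∈ Y :=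
  ⟨fun h0 => by_contra fun hp => (h.neg p hp).ne h0, h.contraction_eq_zero⟩

/-- No integrability is required: a non-integrable function has integral `0` by convention. -/
theorem IsLyapunov.integral_nonpos (h : v.IsLyapunov Y η) (μ : Measure 𝒢.OrbitSpace) :
    ∫ p, v.contraction η p ∂μ ≤ 0 :=
  integral_nonpos_of_ae (Eventually.of_forall h.contraction_nonpos)

/-- A nonnegative integrable function has zero integral exactly when it vanishes almost everywhere;
apply this to `-ι_v η`, whose zero set is `Y`. Integrability matters here, since otherwise the
integral could be `0` merely by convention; it comes from continuity, compactness of `X` and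
finiteness of `μ`. -/
theorem IsLyapunov.integral_eq_zero_iff [CompactSpace 𝒢.OrbitSpace] (h : v.IsLyapunov Y η)
    (μ : Measure 𝒢.OrbitSpace) [IsFiniteMeasure μ] :
    ∫ p, v.contraction η p ∂μ = 0 ↔ μ Yᶜ = 0 := by
  rw [← neg_eq_zero, ← integral_neg, integral_eq_zero_iff_of_nonneg
    (fun p => neg_nonneg.2 (h.contraction_nonpos p))
    (integrable_of_continuous μ (v.continuous_contraction η)).neg]
  -- Vanishing almost everywhere is unfolded to the measure of the exceptional set, which is
  -- literally the complement of `Y` once the zero set is identified.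
  change μ {p | ¬ -v.contraction η p = 0} = 0 ↔ _
  simp only [neg_eq_zero, h.contraction_eq_zero_iff]
  rfl

end BasicVectorField

end ProperEtaleGroupoid

/-! ### Pairing of a Lyapunov class with asymptotic cycles, and its restriction to `Y` -/

theorem proposition1
    {E : Type*} [NormedAddCommGroup E] [NormedSpace ℝ E] [FiniteDimensional ℝ E]
    {M : Type*} [TopologicalSpace M] [ChartedSpace E M] [IsManifold 𝓘(ℝ, E) ∞ M]
    [T2Space M] [SecondCountableTopology M]
    {G : Type*} [TopologicalSpace G] [ChartedSpace E G] [IsManifold 𝓘(ℝ, E) ∞ G]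
    [T2Space G] [SecondCountableTopology G]
    (𝒢 : ProperEtaleGroupoid E M G) [CompactSpace 𝒢.OrbitSpace]
    (v : 𝒢.BasicVectorField) (Φ : Flow ℝ 𝒢.OrbitSpace) (hΦ : v.Generates Φ)
    (Y : Set 𝒢.OrbitSpace) (hY : IsClosed Y) (hYΦ : IsInvariant (fun t p => Φ t p) Y)
    (ξ : 𝒢.DeRhamH1)
    (hξ : ∃ η : 𝒢.closedBasic, ProperEtaleGroupoid.classOf η = ξ ∧ v.IsLyapunov Y η) :
    (∀ μ : ProperEtaleGroupoid.InvariantMeasure Φ,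
      ProperEtaleGroupoid.asymptoticCycle hΦ μ ξ ≤ 0 ∧
        (ProperEtaleGroupoid.asymptoticCycle hΦ μ ξ = 0 ↔ μ.toMeasure Yᶜ = 0)) ∧
      ProperEtaleGroupoid.cechRestriction ξ Y = 0 := by
  obtain ⟨η, rfl, h⟩ := hξ
  refine ⟨fun μ => ?_, ?_⟩
  · have := μ.isFinite
    -- The pairing is evaluated on the Lyapunov representative, which turns both claims into
    -- statements about the integral of `ι_v η`.
    rw [ProperEtaleGroupoid.asymptoticCycle_classOf]
    exact ⟨h.integral_nonpos _, h.integral_eq_zero_iff _⟩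
  · obtain ⟨V, f, hV, hYV, hf, -⟩ := h.exists_primitive
    exact ProperEtaleGroupoid.cechRestriction_classOf_eq_zero hV hYV hf
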